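/- **Lemma (square-freeness of a path along one edge).** *Subdivision.* A tile is a square with corners $CUL, CUR, CDR, CDL$ and sides $U$ ($CUL\to CUR$), $R$ ($CUR\to CDR$), $D$ ($CDL\to CDR$), $L$ ($CUL\to CDL$). Subdividing it means adding the midpoints $U,R,D,L$ of the sides, interior nodes $A,B,C$, and the eight inner edges $UA,\ UB,\ LA,\ AC,\ BC,\ RB,\ CDL\,C,\ CDR\,C$. This gives six tiles, whose own corners $(CUL,CUR,CDR,CDL)$ are, in this order: upper left $(CUL,U,A,L)$, upper right $(CUR,R,B,U)$, middle $(B,C,A,U)$, lower left $(CDL,L,A,C)$, lower right $(CDR,C,B,R)$, bottom $(CDR,D,CDL,C)$. Any of the middle, lower right and bottom tiles may instead be turned by a half-turn, all six tiles may be reflected (exchanging the names $U\leftrightarrow L$, $R\leftrightarrow D$ of their sides), and each inner edge has one of its two sides chosen as its $A$-side, the other being its $B$-side. These choices are arbitrary, but fixed once and for all. When an edge is halved, its halves inherit its $A$-side and $B$-side. *Complexes.* A complex is anything obtained from one square by a finite sequence of the following two operations. (1) Subdivision of all tiles. (2) Pasting: let a path of four edges with five different nodes be given whose two halves, starting from the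 middle node, each run along one long edge; a square subdivided once into six tiles is glued to the complex along this path, so that its corner $CUL$ is the middle node, its upper side is one half and its left side is the other half of the path. A *long edge* of a complex is a side of the initial square or of a pasted square (a border edge), or one of the eight inner edges created in a subdivided tile (initially, in a subdivision or in a pasted square), with all nodes that later subdivisions put on it. *Types and levels.* A node has a type that is determined in the plane region in which it was created and does not change: a corner type; $A$, $B$ or $C$; for the midpoint of a border edge, the name $U,R,D,L$ of the side of the adjacent tile on which it is the midpoint; for the midpoint of another edge, the ordered pair $XY$, where the node is the midpoint of side $X$ of the tile on the $A$-side and of side $Y$ of the tile on the $B$-side. Its level is $1$ if no subdivision has taken place since its creation, $2$ if one has, and $3$ otherwise. *Words.* Nodes are encoded by letters $Y_i$ that record the type, the level and arbitrary further data of the node; edges leaving and entering a node are encoded arbitrarily by letters $Z_i$ and $X_i$. The letters $X_i$, $Y_i$, $Z_i$ are pairwise different; they are the generators of the semigroup $S$. The word of a path lists in turn: node, leaving edge, entering edge, node, leaving edge, $\dots$, node. *Statement.* Let $W$ be a path in a complex that runs, without turning back and in either direction, entirely along one long edge (inner or border; the ends of the long edge are allowed), and that contains no node of type $DL$, $LD$,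 $DR$, $RD$, $RU$, $UR$, $R$ or $D$. Then, for every such encoding, the word of $W$ does not contain two equal consecutive nonempty subwords. -/

import Mathlib

/-- The four sides of a square tile (up, right, down, left). -/
inductive Side
  | U | R | D | L
  deriving DecidableEq

/-- The four corners of a square tile (up-left, up-right, down-right, down-left). -/
inductive Corner
  | CUL | CUR | CDR | CDL
  deriving DecidableEq

/-- The three interior nodes created when a square is subdivided. -/
inductive InnerNode
  | A | B | C
  deriving DecidableEq

/-- Every side has a standard direction: `U` runs `CUL → CUR`, `R` runs `CUR → CDR`,
`D` runs `CDL → CDR`, `L` runs `CUL → CDL`. -/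
def Side.first : Side → Corner
  | .U => .CUL
  | .R => .CUR
  | .D => .CDL
  | .L => .CUL

def Side.last : Side → Corner
  | .U => .CUR
  | .R => .CDR
  | .D => .CDR
  | .L => .CDL

def Side.opposite : Side → Side
  | .U => .D
  | .D => .U
  | .L => .R
  | .R => .L

/-- Reflection of a square in its diagonal `CUL`–`CDR`; it respects the standard directions. -/
def Side.transpose : Side → Side
  | .U => .L
  | .L => .U
  | .R => .D
  | .D => .R

/-- Types of nodes. In `lateral s t` the node is the midpoint of side `s` of the tile on the `A`-side
of its edge and of side `t` of the tile on the `B`-side. -/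
inductive NodeType
  | corner (c : Corner)
  | border (s : Side)
  | inner (i : InnerNode)
  | lateral (s t : Side)
  deriving DecidableEq

/-! ### The subdivision of a square into six squares -/

/-- The eleven points of a subdivided square: corners, midpoints of sides, interior nodes. -/
inductive Pt
  | corner (c : Corner)
  | mid (s : Side)
  | inner (i : InnerNode)

/-- The eight inner edges:
`U–A`, `U–B`, `L–A`, `A–C`, `B–C`, `R–B`, `CDL–C`, `CDR–C`. -/
def innerEnds : Fin 8 → Pt × Pt
  | 0 => (.mid .U, .inner .A)
  | 1 => (.mid .U, .inner .B)
  | 2 => (.mid .L, .inner .A)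
  | 3 => (.inner .A, .inner .C)
  | 4 => (.inner .B, .inner .C)
  | 5 => (.mid .R, .inner .B)
  | 6 => (.corner .CDL, .inner .C)
  | 7 => (.corner .CDR, .inner .C)

/-- The sixteen edges of the subdivided square. `half s false` and `half s true` are the first and
the second half of side `s`, directed as `s`; `inner i` is directed as in `innerEnds`. -/
inductive Seg
  | half (s : Side) (second : Bool)
  | inner (i : Fin 8)
  deriving DecidableEq

inductive SubTile
  | topLeft | topRight | middle | lowerLeft | lowerRight | bottom
  deriving DecidableEq

/-- For each of the six squares and each of its own four sides, the edge that is this side, and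
whether the standard direction of the side agrees with the direction of the edge. The corners
`(CUL, CUR, CDR, CDL)` of the six squares are, in this order:
`(CUL, U, A, L)`, `(CUR, R, B, U)`, `(B, C, A, U)`, `(CDL, L, A, C)`, `(CDR, C, B, R)`,
`(CDR, D, CDL, C)`. -/
def basePlace : SubTile → Side → Seg × Bool
  | .topLeft, .U => (.half .U false, true)
  | .topLeft, .R => (.inner 0, true)
  | .topLeft, .D => (.inner 2, true)
  | .topLeft, .L => (.half .L false, true)
  | .topRight, .U => (.half .R false, true)
  | .topRight, .R => (.inner 5, true)
  | .topRight, .D => (.inner 1, true)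
  | .topRight, .L => (.half .U true, false)
  | .middle, .U => (.inner 4, true)
  | .middle, .R => (.inner 3, false)
  | .middle, .D => (.inner 0, true)
  | .middle, .L => (.inner 1, false)
  | .lowerLeft, .U => (.half .L true, false)
  | .lowerLeft, .R => (.inner 2, true)
  | .lowerLeft, .D => (.inner 3, false)
  | .lowerLeft, .L => (.inner 6, true)
  | .lowerRight, .U => (.inner 7, true)
  | .lowerRight, .R => (.inner 4, false)
  | .lowerRight, .D => (.inner 5, true)
  | .lowerRight, .L => (.half .R true, false)
  | .bottom, .U => (.half .D true, false)
  | .bottom, .R => (.half .D false, false)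
  | .bottom, .D => (.inner 6, false)
  | .bottom, .L => (.inner 7, true)

/-- The free choices in the subdivision rule: which of the middle, lower right and bottom squares
are turned by a half-turn, whether all six squares are reflected in their diagonals, and which of
the two sides of each inner edge is its `A`-side. The rule is fixed once and for all, the same
for all squares. -/
structure SubdivisionRule where
  turnMiddle : Bool
  turnLowerRight : Bool
  turnBottom : Bool
  mirror : Bool
  swapSides : Fin 8 → Bool

namespace SubdivisionRule

variable (c : SubdivisionRule)

def turned : SubTile → Bool
  | .middle => c.turnMiddle
  | .lowerRight => c.turnLowerRight
  | .bottom => c.turnBottom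
  | _ => false

/-- The side table of the rule. A half-turn exchanges opposite sides and reverses directions. -/
def place (j : SubTile) (s : Side) : Seg × Bool :=
  let s' := if c.mirror then s.transpose else s
  if c.turned j then ((basePlace j s'.opposite).1, !(basePlace j s'.opposite).2)
  else basePlace j s'

/-- The sides of the six squares that lie on a given edge of the subdivided square, each with the
information whether the edge runs in the standard direction of that side. -/
def sidesOn (g : Seg) : List (Side × Bool) :=
  ([SubTile.topLeft, .topRight, .middle, .lowerLeft, .lowerRight, .bottom]).flatMap fun j =>
    ([Side.U, .R, .D, .L]).filterMap fun s =>
      if (c.place j s).1 = g then some (s, (c.place j s).2) else none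

/-- Each half of a side of the subdivided square is a side of exactly one of the six squares. -/
theorem length_sidesOn_half (s : Side) (k : Bool) : (c.sidesOn (.half s k)).length = 1 := by
  obtain ⟨a, b, d, e, f⟩ := c
  cases a <;> cases b <;> cases d <;> cases e <;> cases s <;> cases k <;> rfl

/-- Each inner edge of the subdivided square is a side of exactly two of the six squares. -/
theorem length_sidesOn_inner (i : Fin 8) : (c.sidesOn (.inner i)).length = 2 := by
  obtain ⟨a, b, d, e, f⟩ := c
  cases a <;> cases b <;> cases d <;> cases e <;> fin_cases i <;> rfl

/-- An edge that lies on side `x.1` of a square, in the standard direction iff `x.2`, is halved when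
the square is subdivided. The result is the side of the smaller square on which the first
(`k = false`) or second (`k = true`) half of the edge lies, again with its direction. -/
def halfSide (x : Side × Bool) (k : Bool) : Side × Bool :=
  match c.sidesOn (.half x.1 (if x.2 then k else !k)) with
  | y :: _ => (y.1, y.2 == x.2)
  | [] => x

end SubdivisionRule

/-! ### Labelled edges, tiles, complexes -/

/-- Position of an edge in the plane in which it was created: the side (with direction) of the tile
on its `A`-side, and the same for the tile on its `B`-side, which is absent for a border edge. -/
structure EdgeLabel where
  sideA : Side × Bool
  sideB : Option (Side × Bool)

def EdgeLabel.half (c : SubdivisionRule) (l : EdgeLabel) (k : Bool) : EdgeLabel :=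
  ⟨c.halfSide l.sideA k, l.sideB.map fun x => c.halfSide x k⟩

/-- The type of the node that appears in the middle of an edge. -/
def EdgeLabel.midType (l : EdgeLabel) : NodeType :=
  match l.sideB with
  | none => .border l.sideA.1
  | some x => .lateral l.sideA.1 x.1

/-- The label of the `i`-th inner edge of a subdivided square. -/
def SubdivisionRule.innerLabel (c : SubdivisionRule) (i : Fin 8) : EdgeLabel :=
  match c.sidesOn (.inner i) with
  | x :: y :: _ => if c.swapSides i then ⟨y, some x⟩ else ⟨x, some y⟩
  | _ => ⟨(.U, true), none⟩

structure Edge (V : Type) where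
  tail : V
  head : V
  label : EdgeLabel

def Edge.map {V W : Type} (f : V → W) (e : Edge V) : Edge W := ⟨f e.tail, f e.head, e.label⟩

/-- An edge traversed from tail to head (`along = true`) or from head to tail. -/
structure DEdge (V : Type) where
  edge : Edge V
  along : Bool

namespace DEdge

variable {V W : Type}

def start (d : DEdge V) : V := if d.along then d.edge.tail else d.edge.head

def finish (d : DEdge V) : V := if d.along then d.edge.head else d.edge.tail

def reverse (d : DEdge V) : DEdge V := ⟨d.edge, !d.along⟩

def map (f : V → W) (d : DEdge V) : DEdge W := ⟨d.edge.map f, d.along⟩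

end DEdge

/-- A tile is given by its four sides, each traversed in its standard direction. -/
abbrev Tile (V : Type) := Side → DEdge V

def Tile.corner {V : Type} (t : Tile V) : Corner → V
  | .CUL => (t .U).start
  | .CUR => (t .U).finish
  | .CDR => (t .R).finish
  | .CDL => (t .D).start

/-- The `i`-th inner edge of a subdivided square whose points are given by `pt`. -/
def innerEdge {V : Type} (c : SubdivisionRule) (pt : Pt → V) (i : Fin 8) : Edge V :=
  ⟨pt (innerEnds i).1, pt (innerEnds i).2, c.innerLabel i⟩

/-- The `j`-th of the six squares of a subdivided square whose points are given by `pt` and whose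
half-sides, in the standard directions, are given by `halves`. -/
def smallTile {V : Type} (c : SubdivisionRule) (pt : Pt → V) (halves : Side → Bool → DEdge V)
    (j : SubTile) : Tile V := fun s =>
  match c.place j s with
  | (.half s' k, b) => if b then halves s' k else (halves s' k).reverse
  | (.inner i, b) => ⟨innerEdge c pt i, b⟩

/-- A complex: its nodes with their types and ages (number of subdivisions since the creation of
the node), its tiles, and its long edges. A long edge is a side of the initial square, an inner
edge of a macrotile, or a side of a pasted macrotile; it is stored as the sequence of the
present short edges into which it is divided. -/
structure SquareComplex where
  V : Type
  type : V → NodeType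
  age : V → ℕ
  tiles : Set (Tile V)
  longEdges : Set (List (DEdge V))

/-- The level of a node: `1` for nodes just created, `2` for those created at the previous stage,
`3` for all others. -/
def SquareComplex.level (K : SquareComplex) (v : K.V) : ℕ := min (K.age v + 1) 3

/-- A path lies in one long edge: it runs along consecutive short edges of it, in one of the two
directions, without turning back. -/
def SquareComplex.LiesInEdge (K : SquareComplex) (p : List (DEdge K.V)) : Prop :=
  ∃ r ∈ K.longEdges, p <:+: r ∨ (p.reverse.map DEdge.reverse) <:+: r

/-! ### The initial square -/

def squareEdge (s : Side) : Edge Corner := ⟨s.first, s.last, ⟨(s, true), none⟩⟩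

def SquareComplex.square : SquareComplex where
  V := Corner
  type := .corner
  age := fun _ => 0
  tiles := {fun s => ⟨squareEdge s, true⟩}
  longEdges := {r | ∃ s, r = [⟨squareEdge s, true⟩]}

/-! ### Subdivision -/

/-- Nodes after a subdivision: old ones, midpoints of edges, interior nodes of tiles. -/
inductive SubNode (V : Type)
  | old (v : V)
  | mid (e : Edge V)
  | inner (t : Tile V) (i : InnerNode)

def Edge.half {V : Type} (c : SubdivisionRule) (e : Edge V) (k : Bool) : Edge (SubNode V) :=
  if k then ⟨.mid e, .old e.head, e.label.half c true⟩
  else ⟨.old e.tail, .mid e, e.label.half c false⟩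

/-- The half of a directed edge that is traversed first (`k = false`) or second (`k = true`). -/
def DEdge.half {V : Type} (c : SubdivisionRule) (d : DEdge V) (k : Bool) : DEdge (SubNode V) :=
  ⟨d.edge.half c (if d.along then k else !k), d.along⟩

def Tile.subPt {V : Type} (t : Tile V) : Pt → SubNode V
  | .corner x => .old (t.corner x)
  | .mid s => .mid (t s).edge
  | .inner i => .inner t i

/-- Every edge of the complex is halved and every tile is divided into six tiles. -/
def SquareComplex.subdivide (c : SubdivisionRule) (K : SquareComplex) : SquareComplex where
  V := SubNode K.V
  type
    | .old v => K.type v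
    | .mid e => e.label.midType
    | .inner _ i => .inner i
  age
    | .old v => K.age v + 1
    | .mid _ => 0
    | .inner _ _ => 0
  tiles := {τ | ∃ t ∈ K.tiles, ∃ j, τ = smallTile c t.subPt (fun s k => (t s).half c k) j}
  longEdges :=
    {r | ∃ r₀ ∈ K.longEdges, r = r₀.flatMap fun d => [d.half c false, d.half c true]} ∪
    {r | ∃ t ∈ K.tiles, ∃ i, r = [⟨innerEdge c t.subPt i, true⟩]}

/-! ### Pasting -/

/-- Nodes after a pasting: old ones and the six new nodes `A`, `B`, `C`, `R`, `D`, `CDR`. -/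
inductive PasteNode (V : Type)
  | old (v : V)
  | inner (i : InnerNode)
  | right
  | down
  | corner

/-- A place for pasting: a path of four short edges. From its middle node, the core, two short edges
run along one long edge and will be the upper side of the pasted macrotile, and two short edges
run along one long edge and will be its left side. -/
structure PastePlace (K : SquareComplex) where
  top₁ : DEdge K.V
  top₂ : DEdge K.V
  left₁ : DEdge K.V
  left₂ : DEdge K.V
  top_lies : K.LiesInEdge [top₁, top₂]
  left_lies : K.LiesInEdge [left₁, left₂]
  core_eq : left₁.start = top₁.start
  simple : [left₂.finish, left₁.finish, top₁.start, top₁.finish, top₂.finish].Nodup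

namespace PastePlace

variable {K : SquareComplex} (P : PastePlace K)

/-- The eleven points of the pasted macrotile. -/
def pt : Pt → PasteNode K.V
  | .corner .CUL => .old P.top₁.start
  | .corner .CUR => .old P.top₂.finish
  | .corner .CDR => .corner
  | .corner .CDL => .old P.left₂.finish
  | .mid .U => .old P.top₁.finish
  | .mid .R => .right
  | .mid .D => .down
  | .mid .L => .old P.left₁.finish
  | .inner i => .inner i

/-- The short edges on the border of the pasted macrotile. Those on its upper and left sides are
old; those on its right and lower sides are new border edges. -/
def halves (c : SubdivisionRule) : Side → Bool → DEdge (PasteNode K.V)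
  | .U, false => P.top₁.map .old
  | .U, true => P.top₂.map .old
  | .L, false => P.left₁.map .old
  | .L, true => P.left₂.map .old
  | s, false => ⟨⟨P.pt (.corner s.first), P.pt (.mid s), ⟨c.halfSide (s, true) false, none⟩⟩, true⟩
  | s, true => ⟨⟨P.pt (.mid s), P.pt (.corner s.last), ⟨c.halfSide (s, true) true, none⟩⟩, true⟩

end PastePlace

/-- A macrotile consisting of six tiles is pasted to the complex along a path of four edges. -/
def SquareComplex.paste (c : SubdivisionRule) (K : SquareComplex) (P : PastePlace K) : SquareComplex where
  V := PasteNode K.V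
  type
    | .old v => K.type v
    | .inner i => .inner i
    | .right => .border .R
    | .down => .border .D
    | .corner => .corner .CDR
  age
    | .old v => K.age v
    | _ => 0
  tiles :=
    {τ | ∃ t ∈ K.tiles, τ = fun s => (t s).map .old} ∪
    {τ | ∃ j, τ = smallTile c P.pt (P.halves c) j}
  longEdges :=
    {r | ∃ r₀ ∈ K.longEdges, r = r₀.map (DEdge.map .old)} ∪
    {r | ∃ s, r = [P.halves c s false, P.halves c s true]} ∪
    {r | ∃ i, r = [⟨innerEdge c P.pt i, true⟩]}

/-- The family of complexes: all that arises from a square by subdivisions and pastings. -/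
inductive IsComplex (c : SubdivisionRule) : SquareComplex → Prop
  | square : IsComplex c .square
  | subdivide (K : SquareComplex) : IsComplex c K → IsComplex c (K.subdivide c)
  | paste (K : SquareComplex) (P : PastePlace K) : IsComplex c K → IsComplex c (K.paste c P)

/-! ### Encoding words -/

/-- A node letter records the type and the level of a node, and further data. -/
structure NodeLetter (ρ : Type*) where
  type : NodeType
  level : ℕ
  rest : ρ

/-- The generators: letters for edges entering a node, for nodes, and for edges leaving a node. -/
inductive Generator (ρ ε : Type*)
  | X (e : ε)
  | Y (n : NodeLetter ρ)
  | Z (e : ε)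

/-- An encoding of the nodes and half-edges of a complex by letters. The components other than the
type and level of nodes (surroundings, information, position in pasted tiles, kinds of edges)
are arbitrary. -/
structure Coding (K : SquareComplex) (ρ ε : Type*) where
  rest : K.V → ρ
  entering : DEdge K.V → ε
  leaving : DEdge K.V → ε

def Coding.nodeLetter {K : SquareComplex} {ρ ε : Type*} (κ : Coding K ρ ε) (v : K.V) : Generator ρ ε :=
  .Y ⟨K.type v, K.level v, κ.rest v⟩

/-- The word of a path: node, leaving edge, entering edge, node, leaving edge, and so on. -/
def Coding.word {K : SquareComplex} {ρ ε : Type*} (κ : Coding K ρ ε) : List (DEdge K.V) → List (Generator ρ ε)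
  | [] => []
  | d :: p => κ.nodeLetter d.start :: (d :: p).flatMap fun e =>
      [.Z (κ.leaving e), .X (κ.entering e), κ.nodeLetter e.finish]

/-- The node types `DL`, `LD`, `DR`, `RD`, `RU`, `UR`, `R`, `D`. -/
def exceptionalTypes : Set NodeType :=
  {.lateral .D .L, .lateral .L .D, .lateral .D .R, .lateral .R .D, .lateral .R .U, .lateral .U .R,
    .border .R, .border .D}

/-- The word has two equal consecutive nonempty subwords. -/
def HasSquare {α : Type*} (w : List α) : Prop := ∃ q : List α, q ≠ [] ∧ q ++ q <:+: w

/-! The nodes along a long edge form a sequence of Toeplitz (paper-folding) kind: a subdivision puts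
a new node between any two neighbours and leaves the previous sequence at the even positions. Since
the letters `X`, `Y`, `Z` are distinguishable, a square in the word forces the node letters to
repeat with some period `m`. If `m` is odd, a node of level 1 is matched with an older one, which
the levels forbid. If `m` is even, the types forbid it, by the following alternation.

The two halves of a `U` or `L` side lie on one `U` and one `L` side of the small tiles, and their
order depends only on a phase shared by `U` run one way and `L` run the other way
(`exists_halfSide_lateralSide`). Hence, once one flank of a path shows `U` and `L` alternately, it
does so after every subdivision (`Alternating.halve`), and the types of successive new midpoints
differ. A period `2m` with `m` odd is refuted on the new nodes; if `m` is even, restricting to the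
old nodes halves the period, and induction applies (`Tame.halve`).

Edges with no `U` or `L` on either flank escape this argument, but their midpoints are of
exceptional type. So every long edge is a chain of alternating pieces and single edges joined at
exceptional nodes (`Composed`, `IsComplex.composed`), and a path that avoids such nodes stays within
one piece (`Composed.tame`). -/

/-! ### Labels of edges -/

/-- A side `U` or `L`, with the direction determined by a phase. -/
def lateralSide (u k : Bool) : Side × Bool := (if u then .U else .L, u == k)

def EdgeLabel.side (l : EdgeLabel) : Bool → Option (Side × Bool)
  | true => some l.sideA
  | false => l.sideB

/-- The side of the adjacent tile on the `A`-side (`b = true`) or the `B`-side, with its direction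
relative to the direction of the path. -/
def DEdge.side {V : Type} (d : DEdge V) (b : Bool) : Option (Side × Bool) :=
  (d.edge.label.side b).map fun x => (x.1, x.2 == d.along)

def Side.isUL : Side → Bool
  | .U => true
  | .L => true
  | _ => false

/-- One of the adjacent sides is `U` or `L`, or the midpoint of the edge is of exceptional type. -/
def EdgeLabel.legit (l : EdgeLabel) : Bool :=
  match l.sideB with
  | none => true
  | some y => l.sideA.1.isUL || y.1.isUL || (l.sideA.1 != y.1 && l.sideA.2 == y.2)

def EdgeLabel.hasUL (l : EdgeLabel) : Bool :=
  l.sideA.1.isUL || (l.sideB.map fun y => y.1.isUL).getD false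

/-- Without mirroring, the half of `U` next to `CUL` is a `U` side and the other half an `L` side
run backwards; for `L` the names are exchanged. So `U` run forwards and `L` run backwards both yield
`U`, `L` in this order, with the same directions as before. The point is that `u'` and `k'` do not
depend on `u`. -/
theorem SubdivisionRule.exists_halfSide_lateralSide (c : SubdivisionRule) (k : Bool) :
    ∃ u' k' : Bool, ∀ u h : Bool,
      c.halfSide (lateralSide u k) h = lateralSide (u' ^^ h) k' := by
  obtain ⟨a, b, d, e, f⟩ := c
  -- Mirroring (`e`) exchanges the names `U` and `L`, which flips both the first side and the phase.
  refine ⟨k ^^ e, k ^^ e, ?_⟩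
  intro u h
  cases a <;> cases b <;> cases d <;> cases e <;> cases k <;> cases u <;> cases h <;> rfl

/-- For an edge between `R` and `D`, equal directions ensure that the first halves of the two sides
are paired, and so are the second halves. The first half of `R` becomes a `U` or `L` side; the
second halves either involve `U` or `L`, or are again an `R` and a `D` with equal directions. This
is why `legit` has to record directions. -/
theorem SubdivisionRule.legit_half (c : SubdivisionRule) (l : EdgeLabel) (hl : l.legit = true)
    (hu : l.hasUL = false) (k : Bool) : (l.half c k).legit = true := by
  obtain ⟨⟨s, p⟩, _ | ⟨t, q⟩⟩ := l
  · rfl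
  · have h : s.isUL = false ∧ t.isUL = false ∧ s ≠ t ∧ p = q := by
      cases s <;> cases t <;> cases p <;> cases q <;>
        simp_all [EdgeLabel.hasUL, EdgeLabel.legit, Side.isUL]
    clear hl hu
    obtain ⟨hs, ht, hst, rfl⟩ := h
    obtain ⟨a, b, d, e, f⟩ := c
    cases s <;> cases t <;> simp [Side.isUL] at hs ht hst <;>
    · cases p <;> cases a <;> cases b <;> cases d <;> cases e <;> cases k <;> rfl

/-- A finite check over all rules: an inner edge without `U` or `L` separates an `R` from a `D` with
equal directions. -/
theorem SubdivisionRule.legit_innerLabel (c : SubdivisionRule) (i : Fin 8) :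
    (c.innerLabel i).legit = true := by
  obtain ⟨a, b, d, e, f⟩ := c
  rcases hf : f i with _ | _ <;>
  · unfold SubdivisionRule.innerLabel
    simp only [hf]
    clear hf
    cases a <;> cases b <;> cases d <;> cases e <;> fin_cases i <;> rfl

theorem EdgeLabel.midType_mem_exceptionalTypes (l : EdgeLabel) (hl : l.legit = true)
    (hu : l.hasUL = false) : l.midType ∈ exceptionalTypes := by
  obtain ⟨⟨s, p⟩, _ | ⟨t, q⟩⟩ := l
  · cases s <;> simp_all [EdgeLabel.legit, EdgeLabel.hasUL, EdgeLabel.midType, Side.isUL, exceptionalTypes]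
  · cases s <;> cases t <;>
      simp_all [EdgeLabel.legit, EdgeLabel.hasUL, EdgeLabel.midType, Side.isUL, exceptionalTypes]

theorem EdgeLabel.side_eq_of_midType_eq {l l' : EdgeLabel} (h : l.midType = l'.midType) (b : Bool) :
    (l.side b).map Prod.fst = (l'.side b).map Prod.fst := by
  obtain ⟨⟨s, p⟩, _ | ⟨t, q⟩⟩ := l <;> obtain ⟨⟨s', p'⟩, _ | ⟨t', q'⟩⟩ := l' <;>
    cases b <;> simp_all [EdgeLabel.midType, EdgeLabel.side]

theorem DEdge.map_fst_side {V : Type} (d : DEdge V) (b : Bool) :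
    (d.side b).map Prod.fst = (d.edge.label.side b).map Prod.fst := by
  simp [DEdge.side, Function.comp_def]

/-- Running an edge backwards exchanges its halves and also flips the relative direction of the
side, which makes `halfSide` exchange them; the two effects agree. Halving can thus be computed in
the order of the path. -/
theorem DEdge.side_half {V : Type} (c : SubdivisionRule) (d : DEdge V) (k b : Bool) :
    (d.half c k).side b = (d.side b).map fun x => c.halfSide x k := by
  obtain ⟨⟨v, w, ⟨x, y⟩⟩, a⟩ := d
  have key : ∀ z : Side × Bool, ((c.halfSide z (if a then k else !k)).1,
      (c.halfSide z (if a then k else !k)).2 == a) = c.halfSide (z.1, z.2 == a) k := by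
    rintro ⟨s, t⟩
    -- This excludes the default branch of `halfSide`.
    have hne : ∀ g, (c.sidesOn (.half s g)) ≠ [] := fun g h => by
      simpa [h] using c.length_sidesOn_half s g
    unfold SubdivisionRule.halfSide
    cases a <;> cases t <;> cases k <;> simp <;>
      (split
       · simp
       · rename_i h; exact absurd h (hne _))
  have half_eq : (DEdge.mk ⟨v, w, ⟨x, y⟩⟩ a).half c k =
      ⟨(Edge.mk v w ⟨x, y⟩).half c (if a then k else !k), a⟩ := rfl
  have label_eq : ∀ g, ((Edge.mk v w ⟨x, y⟩).half c g).label = EdgeLabel.half c ⟨x, y⟩ g := by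
    intro g; cases g <;> rfl
  rw [half_eq, DEdge.side, label_eq]
  cases b
  · rcases y with _ | z
    · rfl
    · exact congrArg some (key z)
  · exact congrArg some (key x)

theorem DEdge.legit_half {V : Type} (c : SubdivisionRule) (d : DEdge V)
    (hl : d.edge.label.legit = true) (hu : d.edge.label.hasUL = false) (k : Bool) :
    (d.half c k).edge.label.legit = true := by
  unfold DEdge.half Edge.half
  split_ifs <;> exact c.legit_half _ hl hu _

theorem EdgeLabel.exists_side_of_hasUL (l : EdgeLabel) (a : Bool) (h : l.hasUL = true) :
    ∃ b u k, (l.side b).map (fun x => (x.1, x.2 == a)) = some (lateralSide u k) := by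
  have key : ∀ (s : Side) (t : Bool), s.isUL = true → ∃ u k, (s, t == a) = lateralSide u k := by
    intro s t hs
    cases s
    · exact ⟨true, t == a, by simp [lateralSide]⟩
    · simp [Side.isUL] at hs
    · simp [Side.isUL] at hs
    · exact ⟨false, !(t == a), by simp [lateralSide]⟩
  obtain ⟨⟨s, p⟩, y⟩ := l
  by_cases hs : s.isUL = true
  · obtain ⟨u, k, huk⟩ := key s p hs
    exact ⟨true, u, k, by simp [EdgeLabel.side, huk]⟩
  · rcases y with _ | ⟨t, q⟩
    · simp [EdgeLabel.hasUL, hs] at h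
    · obtain ⟨u, k, huk⟩ := key t q (by simpa [EdgeLabel.hasUL, hs] using h)
      exact ⟨false, u, k, by simp [EdgeLabel.side, huk]⟩

/-! ### Paths along which the adjacent sides alternate -/

theorem lateralSide_not (u k : Bool) :
    ((lateralSide u k).1, !(lateralSide u k).2) = lateralSide u (!k) := by
  cases u <;> cases k <;> rfl

theorem lateralSide_fst_injective {u v k : Bool}
    (h : (lateralSide u k).1 = (lateralSide v k).1) : u = v := by
  cases u <;> cases v <;> simp_all [lateralSide]

section Paths

variable {V W : Type}

/-- On one side of the path, the adjacent sides are alternately `U` and `L`. -/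
def Alternating (r : List (DEdge V)) : Prop :=
  ∃ b u k : Bool, ∀ (j : ℕ) (d : DEdge V), r[j]? = some d →
    d.side b = some (lateralSide (u ^^ j.bodd) k)

/-- The edges `e` and nodes `f` of a path. Types of nodes have no repetition of even period, and if
there are at least two edges then every second node is new. -/
structure PathData (ty : V → NodeType) (ag : V → ℕ) (r : List (DEdge V)) (e : ℕ → DEdge V)
    (f : ℕ → V) : Prop where
  getElem : ∀ j < r.length, r[j]? = some (e j)
  start : ∀ j < r.length, (e j).start = f j
  finish : ∀ j < r.length, (e j).finish = f (j + 1)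
  types : ∀ i m, 0 < m → i + 4 * m ≤ r.length + 1 →
    ∃ t < 2 * m, ty (f (i + t)) ≠ ty (f (i + t + 2 * m))
  ages : 2 ≤ r.length → ∃ b, ∀ j ≤ r.length, (ag (f j) = 0 ↔ j.bodd = b)

def Tame (ty : V → NodeType) (ag : V → ℕ) (r : List (DEdge V)) : Prop :=
  ∃ e f, PathData ty ag r e f

variable {ty : V → NodeType} {ag : V → ℕ} {ty' : W → NodeType} {ag' : W → ℕ}

theorem tame_singleton (d : DEdge V) : Tame ty ag [d] := by
  refine ⟨fun _ => d, fun j => if j = 0 then d.start else d.finish, ?_, ?_, ?_, ?_, ?_⟩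
  · intro j hj
    simp at hj; simp [hj]
  · intro j hj
    simp at hj; simp [hj]
  · intro j _
    simp
  · intro i m hm h
    simp at h; omega
  · intro h
    simp at h

theorem tame_nil (v : V) : Tame ty ag ([] : List (DEdge V)) := by
  refine ⟨fun _ => ⟨⟨v, v, ⟨(.U, true), none⟩⟩, true⟩, fun _ => v, ?_, ?_, ?_, ?_, ?_⟩
  · intro j hj; simp at hj
  · intro j hj; simp at hj
  · intro j hj; simp at hj
  · intro i m hm h; simp at h; omega
  · intro h; simp at h

theorem alternating_singleton (d : DEdge V) (h : d.edge.label.hasUL = true) :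
    Alternating [d] := by
  obtain ⟨b, u, k, hb⟩ := d.edge.label.exists_side_of_hasUL d.along h
  refine ⟨b, u, k, fun j d' hj => ?_⟩
  rcases j with _ | j
  · simp at hj
    subst hj
    simpa [DEdge.side] using hb
  · simp at hj

theorem Alternating.of_isInfix {p r : List (DEdge V)} (h : Alternating r) (hp : p <:+: r) :
    Alternating p := by
  obtain ⟨b, u, k, h⟩ := h
  obtain ⟨s, t, rfl⟩ := hp
  refine ⟨b, u ^^ s.length.bodd, k, fun j d hj => ?_⟩
  have := h (s.length + j) d (by
    have hlt : j < p.length := (List.getElem?_eq_some_iff.mp hj).1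
    rw [List.append_assoc, List.getElem?_append_right (by omega)]
    simp [List.getElem?_append_left hlt, hj])
  simpa [Nat.bodd_add] using this

theorem Tame.of_isInfix {p r : List (DEdge V)} (h : Tame ty ag r) (hp : p <:+: r) : Tame ty ag p := by
  obtain ⟨e, f, h⟩ := h
  obtain ⟨s, t, rfl⟩ := hp
  have hlen : (s ++ p ++ t).length = s.length + p.length + t.length := by
    simp [Nat.add_assoc]
  refine ⟨fun j => e (s.length + j), fun j => f (s.length + j), ?_, ?_, ?_, ?_, ?_⟩
  · intro j hj
    rw [← h.getElem _ (by omega), List.append_assoc, List.getElem?_append_right (by omega)]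
    simp [List.getElem?_append_left hj]
  · intro j hj
    exact h.start _ (by omega)
  · intro j hj
    exact h.finish _ (by omega)
  · intro i m hm hi
    obtain ⟨q, hq, hne⟩ := h.types (s.length + i) m hm (by omega)
    exact ⟨q, hq, by simpa only [Nat.add_assoc] using hne⟩
  · intro h2
    obtain ⟨b, hb⟩ := h.ages (by omega)
    refine ⟨s.length.bodd ^^ b, fun j hj => ?_⟩
    rw [hb _ (by omega), Nat.bodd_add]
    cases s.length.bodd <;> cases j.bodd <;> cases b <;> simp

/-- The path traversed in the opposite direction. -/
def reversePath (r : List (DEdge V)) : List (DEdge V) := r.reverse.map DEdge.reverse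

theorem DEdge.reverse_reverse (d : DEdge V) : d.reverse.reverse = d := by
  simp [DEdge.reverse]

theorem DEdge.start_reverse (d : DEdge V) : d.reverse.start = d.finish := by
  obtain ⟨e, a⟩ := d
  cases a <;> rfl

theorem DEdge.finish_reverse (d : DEdge V) : d.reverse.finish = d.start := by
  obtain ⟨e, a⟩ := d
  cases a <;> rfl

theorem reversePath_reversePath (r : List (DEdge V)) : reversePath (reversePath r) = r := by
  simp [reversePath, Function.comp_def, DEdge.reverse_reverse]

theorem getElem?_reversePath (r : List (DEdge V)) (j : ℕ) (hj : j < r.length) :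
    (reversePath r)[j]? = r[r.length - 1 - j]?.map DEdge.reverse := by
  rw [reversePath, List.getElem?_map, List.getElem?_reverse hj]

theorem bodd_sub {a b : ℕ} (h : b ≤ a) : (a - b).bodd = (a.bodd ^^ b.bodd) := by
  obtain ⟨d, rfl⟩ := Nat.exists_eq_add_of_le h
  rw [Nat.add_sub_cancel_left, Nat.bodd_add]
  cases b.bodd <;> simp

theorem Alternating.reverse {r : List (DEdge V)} (h : Alternating r) :
    Alternating (reversePath r) := by
  obtain ⟨b, u, k, h⟩ := h
  -- The pattern now starts with the old last edge, and every relative direction is reversed, which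
  -- negates the phase.
  refine ⟨b, u ^^ (r.length - 1).bodd, !k, fun j d hj => ?_⟩
  have hlt : j < r.length := by
    simpa [reversePath] using (List.getElem?_eq_some_iff.mp hj).1
  rw [getElem?_reversePath r j hlt, Option.map_eq_some_iff] at hj
  obtain ⟨d, hd, rfl⟩ := hj
  have := h _ _ hd
  rw [bodd_sub (by omega)] at this
  rw [Bool.xor_assoc, ← lateralSide_not]
  rw [DEdge.side, Option.map_eq_some_iff] at this
  obtain ⟨x, hx, hx'⟩ := this
  rw [DEdge.side, DEdge.reverse, hx, ← hx']
  obtain ⟨x₁, x₂⟩ := x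
  cases x₂ <;> cases d.along <;> rfl

theorem Tame.reverse {r : List (DEdge V)} (h : Tame ty ag r) : Tame ty ag (reversePath r) := by
  obtain ⟨e, f, h⟩ := h
  have hlen : (reversePath r).length = r.length := by simp [reversePath]
  refine ⟨fun j => (e (r.length - 1 - j)).reverse, fun j => f (r.length - j), ?_, ?_, ?_, ?_, ?_⟩
  · intro j hj
    rw [hlen] at hj
    rw [getElem?_reversePath r j hj, h.getElem _ (by omega)]
    rfl
  · intro j hj
    rw [DEdge.start_reverse, h.finish _ (by omega)]
    congr 1; omega
  · intro j hj
    rw [DEdge.finish_reverse, h.start _ (by omega)]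
    congr 1; omega
  · intro i m hm hi
    rw [hlen] at hi
    -- This is the mirror image of the window of `4 * m` nodes starting at `i`; offset `q` in it
    -- corresponds to offset `2 * m - 1 - q`, with the two compared nodes exchanged.
    obtain ⟨q, hq, hne⟩ := h.types (r.length + 1 - i - 4 * m) m hm (by omega)
    refine ⟨2 * m - 1 - q, by omega, ?_⟩
    intro heq
    apply hne
    have e₁ : r.length + 1 - i - 4 * m + q = r.length - (i + (2 * m - 1 - q) + 2 * m) := by omega
    have e₂ : r.length + 1 - i - 4 * m + q + 2 * m = r.length - (i + (2 * m - 1 - q)) := by omega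
    rw [e₂, e₁]
    exact heq.symm
  · intro h2
    rw [hlen] at h2
    obtain ⟨b, hb⟩ := h.ages h2
    refine ⟨r.length.bodd ^^ b, fun j hj => ?_⟩
    rw [hlen] at hj
    rw [hb _ (by omega), bodd_sub hj]
    cases r.length.bodd <;> cases j.bodd <;> cases b <;> simp

theorem DEdge.start_map (g : V → W) (d : DEdge V) : (d.map g).start = g d.start := by
  obtain ⟨e, a⟩ := d
  cases a <;> rfl

theorem DEdge.finish_map (g : V → W) (d : DEdge V) : (d.map g).finish = g d.finish := by
  obtain ⟨e, a⟩ := d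
  cases a <;> rfl

theorem Alternating.map (g : V → W) {r : List (DEdge V)} (h : Alternating r) :
    Alternating (r.map (DEdge.map g)) := by
  obtain ⟨b, u, k, h⟩ := h
  refine ⟨b, u, k, fun j d hj => ?_⟩
  rw [List.getElem?_map, Option.map_eq_some_iff] at hj
  obtain ⟨d, hd, rfl⟩ := hj
  exact h j d hd

theorem Tame.map {g : V → W} (hty : ∀ v, ty' (g v) = ty v) (hag : ∀ v, ag' (g v) = ag v)
    {r : List (DEdge V)} (h : Tame ty ag r) : Tame ty' ag' (r.map (DEdge.map g)) := by
  obtain ⟨e, f, h⟩ := h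
  refine ⟨fun j => (e j).map g, fun j => g (f j), ?_, ?_, ?_, ?_, ?_⟩ <;> simp only [List.length_map]
  · intro j hj
    rw [List.getElem?_map, h.getElem j hj]
    rfl
  · intro j hj
    rw [DEdge.start_map, h.start j hj]
  · intro j hj
    rw [DEdge.finish_map, h.finish j hj]
  · simpa only [hty] using h.types
  · simpa only [hag] using h.ages

/-! ### Subdivision of paths -/

/-- The path after a subdivision. -/
def halvePath (c : SubdivisionRule) (r : List (DEdge V)) : List (DEdge (SubNode V)) :=
  r.flatMap fun d => [d.half c false, d.half c true]

theorem length_halvePath (c : SubdivisionRule) (r : List (DEdge V)) :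
    (halvePath c r).length = 2 * r.length := by
  simp [halvePath, List.length_flatMap]; omega

theorem getElem?_halvePath (c : SubdivisionRule) (r : List (DEdge V)) (j : ℕ) :
    (halvePath c r)[j]? = r[j.div2]?.map fun d => d.half c j.bodd := by
  induction r generalizing j with
  | nil => simp [halvePath]
  | cons d r ih =>
    rcases j with _ | _ | j
    · simp [halvePath]
    · simp [halvePath]
    · have h := ih j
      simp only [halvePath] at h
      simp only [halvePath, List.flatMap_cons]
      cases hj : j.bodd <;> simp [h, hj]

theorem DEdge.start_half_false (c : SubdivisionRule) (d : DEdge V) :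
    (d.half c false).start = .old d.start := by
  obtain ⟨e, a⟩ := d
  cases a <;> rfl

theorem DEdge.finish_half_false (c : SubdivisionRule) (d : DEdge V) :
    (d.half c false).finish = .mid d.edge := by
  obtain ⟨e, a⟩ := d
  cases a <;> rfl

theorem DEdge.start_half_true (c : SubdivisionRule) (d : DEdge V) :
    (d.half c true).start = .mid d.edge := by
  obtain ⟨e, a⟩ := d
  cases a <;> rfl

theorem DEdge.finish_half_true (c : SubdivisionRule) (d : DEdge V) :
    (d.half c true).finish = .old d.finish := by
  obtain ⟨e, a⟩ := d
  cases a <;> rfl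

/-- All edges share one phase, so each contributes the same block of two sides, and the blocks fit
together into an alternating sequence. -/
theorem Alternating.halve (c : SubdivisionRule) {r : List (DEdge V)} (h : Alternating r) :
    Alternating (halvePath c r) := by
  obtain ⟨b, u, k, h⟩ := h
  obtain ⟨u', k', hc⟩ := c.exists_halfSide_lateralSide k
  refine ⟨b, u', k', fun j d hj => ?_⟩
  rw [getElem?_halvePath, Option.map_eq_some_iff] at hj
  obtain ⟨d, hd, rfl⟩ := hj
  rw [DEdge.side_half, h _ _ hd, Option.map_some, hc]

theorem Alternating.midType_ne {r : List (DEdge V)} (h : Alternating r) {i j : ℕ} {d d' : DEdge V}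
    (hi : r[i]? = some d) (hj : r[j]? = some d') (hij : i.bodd ≠ j.bodd) :
    d.edge.label.midType ≠ d'.edge.label.midType := by
  obtain ⟨b, u, k, h⟩ := h
  intro heq
  have h1 := EdgeLabel.side_eq_of_midType_eq heq b
  rw [← DEdge.map_fst_side, ← DEdge.map_fst_side, h _ _ hi, h _ _ hj, Option.map_some,
    Option.map_some, Option.some_inj] at h1
  exact hij (by simpa using lateralSide_fst_injective h1)

variable {tyS : SubNode V → NodeType} {agS : SubNode V → ℕ}

/-- Old nodes occupy the even positions and midpoints the odd ones. A period divisible by 4 descends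
to half that period on the old nodes; a period that is twice an odd number fails on the midpoints,
whose types alternate. -/
theorem Tame.halve (c : SubdivisionRule) (hold : ∀ v, tyS (.old v) = ty v)
    (hmid : ∀ e, tyS (.mid e) = e.label.midType) (hag_old : ∀ v, agS (.old v) = ag v + 1)
    (hag_mid : ∀ e, agS (.mid e) = 0) {r : List (DEdge V)} (h : Tame ty ag r)
    (hr : Alternating r) : Tame tyS agS (halvePath c r) := by
  obtain ⟨e, f, h⟩ := h
  have hlen := length_halvePath c r
  set g : ℕ → SubNode V := fun j => if j.bodd then .mid (e j.div2).edge else .old (f j.div2)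
    with hg
  have g_even : ∀ j, g (2 * j) = .old (f j) := fun j => by simp [hg, Nat.div2_val]
  have g_odd : ∀ j, g (2 * j + 1) = .mid (e j).edge := fun j => by
    simp [hg, Nat.div2_val, show (2 * j + 1) / 2 = j by omega]
  refine ⟨fun j => (e j.div2).half c j.bodd, g, ?_, ?_, ?_, ?_, ?_⟩ <;> rw [hlen]
  · intro j hj
    rw [getElem?_halvePath, h.getElem _ (by rw [Nat.div2_val]; omega)]
    rfl
  · intro j hj
    obtain ⟨i, rfl | rfl⟩ := Nat.even_or_odd' j
    · rw [g_even, ← h.start i (by omega)]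
      simp [Nat.div2_val, DEdge.start_half_false]
    · rw [g_odd]
      simp [Nat.div2_val, DEdge.start_half_true]
  · intro j hj
    obtain ⟨i, rfl | rfl⟩ := Nat.even_or_odd' j
    · rw [g_odd]
      simp [Nat.div2_val, DEdge.finish_half_false]
    · rw [show 2 * i + 1 + 1 = 2 * (i + 1) by ring, g_even, ← h.finish i (by omega)]
      simp [Nat.div2_val, DEdge.finish_half_true]
  · intro i m hm hi
    obtain ⟨k, rfl | rfl⟩ := Nat.even_or_odd' m
    -- The first even position not before `i` is `2 * ((i + 1) / 2)`.
    · obtain ⟨t, ht, hne⟩ := h.types ((i + 1) / 2) k (by omega) (by omega)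
      refine ⟨2 * ((i + 1) / 2 + t) - i, by omega, ?_⟩
      rw [show i + (2 * ((i + 1) / 2 + t) - i) = 2 * ((i + 1) / 2 + t) by omega,
        show 2 * ((i + 1) / 2 + t) + 2 * (2 * k) = 2 * ((i + 1) / 2 + t + 2 * k) by omega,
        g_even, g_even, hold, hold]
      exact hne
    -- This is the first odd position not before `i`. The period moves its midpoint by an odd number
    -- of edges of `r`.
    · have e₁ : i + (1 - i % 2) = 2 * (i / 2) + 1 := by omega
      refine ⟨1 - i % 2, by omega, ?_⟩
      rw [e₁, show 2 * (i / 2) + 1 + 2 * (2 * k + 1) = 2 * (i / 2 + (2 * k + 1)) + 1 by omega,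
        g_odd, g_odd, hmid, hmid]
      refine hr.midType_ne (h.getElem _ (by omega)) (h.getElem _ (by omega)) ?_
      simp [Nat.bodd_add]
  · intro _
    refine ⟨true, fun j _ => ?_⟩
    obtain ⟨i, rfl | rfl⟩ := Nat.even_or_odd' j
    · simp [g_even, hag_old]
    · simp [g_odd, hag_mid]

end Paths

/-! ### Long edges -/

/-- A path composed of pieces with alternating sides and single short edges, where different pieces
meet at nodes of exceptional types. -/
inductive Composed {V : Type} (ty : V → NodeType) (ag : V → ℕ) : List (DEdge V) → Prop
  | alternating (r : List (DEdge V)) : Alternating r → Tame ty ag r → Composed ty ag r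
  | single (d : DEdge V) : d.edge.label.legit = true → Composed ty ag [d]
  | append (r s : List (DEdge V)) : Composed ty ag r → Composed ty ag s →
      (∀ d ∈ r.getLast?, ty d.finish ∈ exceptionalTypes) →
      (∀ d ∈ s.head?, ty d.start ∈ exceptionalTypes) → Composed ty ag (r ++ s)

namespace Composed

variable {V W : Type} {ty : V → NodeType} {ag : V → ℕ} {ty' : W → NodeType} {ag' : W → ℕ}

theorem of_eq_nil {p : List (DEdge V)} (v : V) (h : p = []) : Composed ty ag p := by
  subst h
  exact .alternating _ ⟨true, true, true, fun j d hj => by simp at hj⟩ (tame_nil v)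

theorem of_isInfix {p r : List (DEdge V)} (h : Composed ty ag r) (hp : p <:+: r) :
    Composed ty ag p := by
  induction h generalizing p with
  | alternating r h₁ h₂ => exact .alternating _ (h₁.of_isInfix hp) (h₂.of_isInfix hp)
  | single d h =>
    by_cases hnil : p = []
    · exact of_eq_nil d.start hnil
    · have hlen := hp.length_le
      have : p = [d] := hp.eq_of_length (by
        have := List.length_pos_iff.mpr hnil
        simp at hlen ⊢; omega)
      rw [this]
      exact .single d h
  | append r s _ _ hl hh ih₁ ih₂ =>
    rcases List.infix_append_iff_ne_nil.mp hp with h | h | ⟨a, b, ha, hb, rfl, ⟨a', rfl⟩, ⟨b', rfl⟩⟩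
    · exact ih₁ h
    · exact ih₂ h
    · refine .append _ _ (ih₁ (List.suffix_append _ _).isInfix)
        (ih₂ (List.prefix_append _ _).isInfix) (fun d hd => hl d ?_) (fun d hd => hh d ?_)
      · rw [List.getLast?_append, hd]; rfl
      · rw [List.head?_append, hd]; rfl

theorem reverse {r : List (DEdge V)} (h : Composed ty ag r) :
    Composed ty ag (reversePath r) := by
  induction h with
  | alternating r h₁ h₂ => exact .alternating _ h₁.reverse h₂.reverse
  | single d h => exact .single d.reverse h
  | append r s _ _ hl hh ih₁ ih₂ =>
    have : reversePath (r ++ s) = reversePath s ++ reversePath r := by simp [reversePath]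
    rw [this]
    refine .append _ _ ih₂ ih₁ (fun d hd => ?_) (fun d hd => ?_)
    · simp only [reversePath, List.getLast?_map, List.getLast?_reverse, Option.mem_def,
        Option.map_eq_some_iff] at hd
      obtain ⟨d, hd, rfl⟩ := hd
      rw [DEdge.finish_reverse]
      exact hh d hd
    · simp only [reversePath, List.head?_map, List.head?_reverse, Option.mem_def,
        Option.map_eq_some_iff] at hd
      obtain ⟨d, hd, rfl⟩ := hd
      rw [DEdge.start_reverse]
      exact hl d hd

theorem map {g : V → W} (hty : ∀ v, ty' (g v) = ty v) (hag : ∀ v, ag' (g v) = ag v)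
    {r : List (DEdge V)} (h : Composed ty ag r) : Composed ty' ag' (r.map (DEdge.map g)) := by
  induction h with
  | alternating r h₁ h₂ => exact .alternating _ (h₁.map g) (h₂.map hty hag)
  | single d h => exact .single (d.map g) h
  | append r s _ _ hl hh ih₁ ih₂ =>
    rw [List.map_append]
    refine .append _ _ ih₁ ih₂ (fun d hd => ?_) (fun d hd => ?_)
    · simp only [List.getLast?_map, Option.mem_def, Option.map_eq_some_iff] at hd
      obtain ⟨d, hd, rfl⟩ := hd
      rw [DEdge.finish_map, hty]
      exact hl d hd
    · simp only [List.head?_map, Option.mem_def, Option.map_eq_some_iff] at hd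
      obtain ⟨d, hd, rfl⟩ := hd
      rw [DEdge.start_map, hty]
      exact hh d hd

/-- A nonempty first part would end at an exceptional node, so no genuine junction can occur. -/
theorem tame {r : List (DEdge V)} (h : Composed ty ag r)
    (havoid : ∀ d ∈ r, ty d.start ∉ exceptionalTypes ∧ ty d.finish ∉ exceptionalTypes) :
    Tame ty ag r := by
  induction h with
  | alternating r _ h => exact h
  | single d _ => exact tame_singleton d
  | append r s _ _ hl hh ih₁ ih₂ =>
    rcases List.eq_nil_or_concat r with rfl | ⟨r, d, rfl⟩
    · exact ih₂ (by simpa using havoid)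
    · exact absurd (hl d (by simp)) (havoid d (by simp)).2

variable {tyS : SubNode V → NodeType} {agS : SubNode V → ℕ}

/-- Alternating pieces remain alternating, and a single edge with `U` or `L` on a flank becomes one.
Any other single edge splits at its exceptional midpoint into two single legitimate edges. Old
junctions persist, since types never change. -/
theorem halve (c : SubdivisionRule) (hold : ∀ v, tyS (.old v) = ty v)
    (hmid : ∀ e, tyS (.mid e) = e.label.midType) (hag_old : ∀ v, agS (.old v) = ag v + 1)
    (hag_mid : ∀ e, agS (.mid e) = 0) {r : List (DEdge V)} (h : Composed ty ag r) :
    Composed tyS agS (halvePath c r) := by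
  induction h with
  | alternating r h₁ h₂ =>
    exact .alternating _ (h₁.halve c) (h₂.halve c hold hmid hag_old hag_mid h₁)
  | single d h =>
    by_cases hu : d.edge.label.hasUL = true
    · exact .alternating _ ((alternating_singleton d hu).halve c)
        ((tame_singleton (ty := ty) (ag := ag) d).halve c hold hmid hag_old hag_mid
          (alternating_singleton d hu))
    · rw [Bool.not_eq_true] at hu
      have hex := d.edge.label.midType_mem_exceptionalTypes h hu
      rw [← hmid] at hex
      refine .append [d.half c false] [d.half c true] (.single _ (d.legit_half c h hu _))
        (.single _ (d.legit_half c h hu _)) ?_ ?_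
      · rintro _ ⟨⟩
        exact (d.finish_half_false c).symm ▸ hex
      · rintro _ ⟨⟩
        exact (d.start_half_true c).symm ▸ hex
  | append r s _ _ hl hh ih₁ ih₂ =>
    have : halvePath c (r ++ s) = halvePath c r ++ halvePath c s := by simp [halvePath]
    rw [this]
    refine .append _ _ ih₁ ih₂ (fun x hx => ?_) (fun x hx => ?_)
    · rcases List.eq_nil_or_concat r with rfl | ⟨r, d, rfl⟩
      · simp [halvePath] at hx
      · have : d.half c true = x := by simpa [halvePath] using hx
        rw [← this, DEdge.finish_half_true, hold]
        exact hl d (by simp)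
    · rcases s with _ | ⟨d, s⟩
      · simp [halvePath] at hx
      · have : d.half c false = x := by simpa [halvePath] using hx
        rw [← this, DEdge.start_half_false, hold]
        exact hh d (by simp)

end Composed

theorem SquareComplex.composed_of_liesInEdge {K : SquareComplex}
    (hK : ∀ r ∈ K.longEdges, Composed K.type K.age r) {p : List (DEdge K.V)}
    (hp : K.LiesInEdge p) : Composed K.type K.age p := by
  obtain ⟨r, hr, h | h⟩ := hp
  · exact (hK r hr).of_isInfix h
  · rw [← reversePath_reversePath p]
    exact ((hK r hr).of_isInfix h).reverse

/-- Newly created edges start as single legitimate edges. In a pasted macrotile the upper and left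
sides are paths in existing long edges, so they inherit the property, while the right and lower
sides are two border edges meeting at a new node of type `R` or `D`. -/
theorem IsComplex.composed {c : SubdivisionRule} {K : SquareComplex} (hK : IsComplex c K) :
    ∀ r ∈ K.longEdges, Composed K.type K.age r := by
  induction hK with
  | square =>
    rintro _ ⟨s, rfl⟩
    exact .single _ rfl
  | subdivide K _ ih =>
    rintro _ (⟨r, hr, rfl⟩ | ⟨t, _, i, rfl⟩)
    · exact (ih r hr).halve c (fun _ => rfl) (fun _ => rfl) (fun _ => rfl) (fun _ => rfl)
    · exact .single _ (c.legit_innerLabel i)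
  | paste K P _ ih =>
    have hmap : ∀ r, Composed K.type K.age r →
        Composed (K.paste c P).type (K.paste c P).age (r.map (DEdge.map .old)) :=
      fun r h => h.map (g := PasteNode.old) (fun _ => rfl) (fun _ => rfl)
    rintro _ ((⟨r, hr, rfl⟩ | ⟨s, rfl⟩) | ⟨i, rfl⟩)
    · exact hmap r (ih r hr)
    · have hnew : ∀ d d' : DEdge (PasteNode K.V), d.edge.label.legit = true →
          d'.edge.label.legit = true → (K.paste c P).type d.finish ∈ exceptionalTypes →
          (K.paste c P).type d'.start ∈ exceptionalTypes →
          Composed (K.paste c P).type (K.paste c P).age [d, d'] := by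
        intro d d' h h' hd hd'
        refine .append [d] [d'] (.single _ h) (.single _ h') ?_ ?_
        · rintro _ ⟨⟩; exact hd
        · rintro _ ⟨⟩; exact hd'
      have hR : NodeType.border .R ∈ exceptionalTypes := by simp [exceptionalTypes]
      have hD : NodeType.border .D ∈ exceptionalTypes := by simp [exceptionalTypes]
      cases s
      · exact hmap _ (K.composed_of_liesInEdge ih P.top_lies)
      · exact hnew _ _ rfl rfl hR hR
      · exact hnew _ _ rfl rfl hD hD
      · exact hmap _ (K.composed_of_liesInEdge ih P.left_lies)
    · exact .single _ (c.legit_innerLabel i)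

/-! ### Words -/

section Words

variable {ρ ε : Type*}

def Generator.kind : Generator ρ ε → ℕ
  | .Y _ => 0
  | .Z _ => 1
  | .X _ => 2

namespace Coding

variable {K : SquareComplex} (κ : Coding K ρ ε)

def edgeWord (d : DEdge K.V) : List (Generator ρ ε) :=
  [.Z (κ.leaving d), .X (κ.entering d), κ.nodeLetter d.finish]

theorem word_eq {p : List (DEdge K.V)} {d : DEdge K.V} (h : p[0]? = some d) :
    κ.word p = κ.nodeLetter d.start :: p.flatMap κ.edgeWord := by
  rcases p with _ | ⟨d', p⟩
  · simp at h
  · simp only [List.getElem?_cons_zero, Option.some_inj] at h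
    subst h
    rfl

theorem length_flatMap_edgeWord (p : List (DEdge K.V)) :
    (p.flatMap κ.edgeWord).length = 3 * p.length := by
  simp [List.length_flatMap, edgeWord]; omega

theorem kind_flatMap_edgeWord (p : List (DEdge K.V)) (j : ℕ) (a : Generator ρ ε)
    (h : (p.flatMap κ.edgeWord)[j]? = some a) : a.kind = (j + 1) % 3 := by
  induction p generalizing j with
  | nil => simp at h
  | cons d p ih =>
    rcases j with _ | _ | _ | j
    · simp [edgeWord] at h; subst h; rfl
    · simp [edgeWord] at h; subst h; rfl
    · simp [edgeWord] at h; subst h; rfl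
    · rw [ih j (by simpa [edgeWord] using h)]
      omega

theorem getElem?_flatMap_edgeWord (p : List (DEdge K.V)) (j : ℕ) :
    (p.flatMap κ.edgeWord)[3 * j + 2]? = p[j]?.map fun d => κ.nodeLetter d.finish := by
  induction p generalizing j with
  | nil => simp
  | cons d p ih =>
    rcases j with _ | j
    · simp [edgeWord]
    · simpa [edgeWord, Nat.mul_add] using ih j

/-- The kind of a letter is determined by its position modulo 3, so a square spans whole periods of
node letters. Odd periods contradict the ages, even ones the types. -/
theorem not_hasSquare_word {p : List (DEdge K.V)} (h : Tame K.type K.age p) :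
    ¬ HasSquare (κ.word p) := by
  rintro ⟨q, hq, s, t, hw⟩
  have hqpos := List.length_pos_iff.mpr hq
  rcases Nat.eq_zero_or_pos p.length with h0 | hpos
  · rw [List.length_eq_zero_iff] at h0
    subst h0
    simp [word] at hw
    exact hq hw.2.1
  obtain ⟨e, f, h⟩ := h
  have hword := κ.word_eq (h.getElem 0 hpos)
  have hlen : (κ.word p).length = 3 * p.length + 1 := by
    rw [hword, List.length_cons, length_flatMap_edgeWord]
  have hkind : ∀ j a, (κ.word p)[j]? = some a → a.kind = j % 3 := by
    intro j a hj
    rw [hword] at hj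
    rcases j with _ | j
    · simp at hj; subst hj; rfl
    · exact κ.kind_flatMap_edgeWord p j a (by simpa using hj)
  have hnode : ∀ j ≤ p.length, (κ.word p)[3 * j]? = some (κ.nodeLetter (f j)) := by
    intro j hj
    rw [hword]
    rcases j with _ | j
    · simp [h.start 0 hpos]
    · rw [show 3 * (j + 1) = 3 * j + 2 + 1 by ring, List.getElem?_cons_succ,
        getElem?_flatMap_edgeWord, h.getElem j (by omega), Option.map_some, h.finish j (by omega)]
  have hlen' : s.length + 2 * q.length + t.length = 3 * p.length + 1 := by
    rw [← hlen, ← hw]; simp; omega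
  have hrep : ∀ j, s.length ≤ j → j < s.length + q.length →
      (κ.word p)[j]? = (κ.word p)[j + q.length]? ∧ ∃ a, (κ.word p)[j]? = some a := by
    intro j hj hj'
    obtain ⟨i, rfl⟩ := Nat.exists_eq_add_of_le hj
    have hi : i < q.length := by omega
    rw [← hw]
    have h₁ : (s ++ (q ++ q) ++ t)[s.length + i]? = q[i]? := by
      rw [List.append_assoc, List.getElem?_append_right (by omega), List.append_assoc,
        Nat.add_sub_cancel_left, List.getElem?_append_left hi]
    have h₂ : (s ++ (q ++ q) ++ t)[s.length + i + q.length]? = q[i]? := by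
      rw [List.append_assoc, List.getElem?_append_right (by omega), List.append_assoc,
        List.getElem?_append_right (by omega), List.getElem?_append_left (by omega)]
      congr 1; omega
    rw [h₁, h₂]
    exact ⟨rfl, q[i], by simp [hi]⟩
  obtain ⟨m, hm⟩ : ∃ m, q.length = 3 * m := by
    obtain ⟨h₁, a, ha⟩ := hrep s.length le_rfl (by omega)
    have h₂ := hkind _ _ ha
    have h₃ := hkind _ _ (h₁ ▸ ha)
    exact ⟨q.length / 3, by omega⟩
  -- Node `j` stands at position `3 * j`, so `(s.length + 2) / 3` is the first node inside the
  -- square. Equal levels give only that the ages vanish together, which suffices.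
  have hperiod : ∀ i < m, K.type (f ((s.length + 2) / 3 + i)) =
      K.type (f ((s.length + 2) / 3 + i + m)) ∧
      (K.age (f ((s.length + 2) / 3 + i)) = 0 ↔ K.age (f ((s.length + 2) / 3 + i + m)) = 0) := by
    intro i hi
    have h₁ := (hrep (3 * ((s.length + 2) / 3 + i)) (by omega) (by omega)).1
    rw [hm, ← Nat.mul_add, hnode _ (by omega), hnode _ (by omega), Option.some_inj] at h₁
    simp only [nodeLetter, Generator.Y.injEq, NodeLetter.mk.injEq, SquareComplex.level] at h₁
    exact ⟨h₁.1, by omega⟩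
  obtain ⟨k, rfl | rfl⟩ := Nat.even_or_odd' m
  · obtain ⟨i, hi, hne⟩ := h.types ((s.length + 2) / 3) k (by omega) (by omega)
    exact hne (hperiod i hi).1
  -- A square of length at least 6 requires at least two edges, so the alternation of ages is
  -- available.
  · obtain ⟨b, hb⟩ := h.ages (by omega)
    have h₁ := (hperiod 0 (by omega)).2
    rw [hb _ (by omega), hb _ (by omega)] at h₁
    simp only [Nat.bodd_add, Nat.bodd_mul, Nat.bodd_two, Nat.bodd_one, Nat.bodd_zero] at h₁
    cases b <;> cases ((s.length + 2) / 3).bodd <;> simp at h₁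

end Coding

end Words

theorem mainTheorem3 (c : SubdivisionRule) (K : SquareComplex) (hK : IsComplex c K)
    {ρ ε : Type*} (κ : Coding K ρ ε) (p : List (DEdge K.V)) (hp : K.LiesInEdge p)
    (havoid : ∀ d ∈ p, K.type d.start ∉ exceptionalTypes ∧ K.type d.finish ∉ exceptionalTypes) :
    ¬ HasSquare (κ.word p) :=
  κ.not_hasSquare_word ((K.composed_of_liesInEdge hK.composed hp).tame havoid)
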